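/- Let $G$ be a countable (finite or infinite) discrete group that is virtually nilpotent, i.e. has a nilpotent subgroup of finite index. Then $G$ is congruent monotileable. That is, there is a sequence $(F_n)_{n\ge 0}$ of nonempty finite subsets of $G$ such that: 1. (right Følner) for every $g\in G$, $\displaystyle\lim_{n\to\infty}\frac{|F_n g\setminus F_n|}{|F_n|}=0$; 2. (left monotiles) for every $n\ge 0$ there is a set $C_n\subseteq G$ such that the left translates $cF_n$, $c\in C_n$, are pairwise disjoint and have union $G$; 3. (congruent) $1_G\in F_0$, and for every $n\ge 0$ there is a set $J_n\subseteq G$ with $1_G\in J_n$ such that the left translates $cF_n$, $c\in J_n$, are pairwise disjoint and have union $F_{n+1}$; 4. (exhaustive) $G=\bigcup_{n\ge 0}F_n$. -/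

import Mathlib

open scoped Pointwise

/-- The family of left translates `c F`, `c ∈ C`, is a partition of the set `A`:
the translates are pairwise disjoint, and their union is `A`. -/
def IsLeftTiling {G : Type*} [Group G] (C F A : Set G) : Prop :=
  C.PairwiseDisjoint (fun c => c • F) ∧ ⋃ c ∈ C, c • F = A

/-- A left monotile of `G`: a finite subset such that `G` is partitioned by some family of
left translates of it. -/
def IsLeftMonotile {G : Type*} [Group G] (F : Finset G) : Prop :=
  ∃ C : Set G, IsLeftTiling C (F : Set G) Set.univ

/-- A right Følner sequence of `G`: a sequence of (nonempty) finite subsets with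
`|F n * g \ F n| / |F n| → 0` for every `g`. -/
def IsRightFolnerSeq {G : Type*} [Group G] (F : ℕ → Finset G) : Prop :=
  (∀ n, (F n).Nonempty) ∧
    ∀ g : G, Filter.Tendsto
      (fun n => ((((F n : Set G) * {g}) \ (F n : Set G)).ncard : ℝ) / ((F n).card : ℝ))
      Filter.atTop (nhds 0)

/-- A congruent sequence: `1 ∈ F 0`, and each `F (n + 1)` is partitioned by left translates
of `F n`, one of which is `F n` itself. -/
def IsCongruentSeq {G : Type*} [Group G] (F : ℕ → Finset G) : Prop :=
  (1 : G) ∈ F 0 ∧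
    ∀ n, ∃ J : Set G, (1 : G) ∈ J ∧ IsLeftTiling J (F n : Set G) (F (n + 1) : Set G)

/-- A group is congruent monotileable if it has a congruent, exhaustive right Følner sequence
made of left monotiles. -/
def IsCongruentMonotileable (G : Type*) [Group G] : Prop :=
  ∃ F : ℕ → Finset G, IsRightFolnerSeq F ∧ (∀ n, IsLeftMonotile (F n)) ∧
    IsCongruentSeq F ∧ ⋃ n, (F n : Set G) = Set.univ

/-! A member of a good family can be enlarged, by tiling, to members as big and as invariant as
desired. Enumerating a countable group and enlarging repeatedly therefore gives the required
sequence (`IsGood.isCongruentMonotileable`); its terms are monotiles because the tilings are nested.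
It remains to find one good set.

For finite and cyclic groups `{1}` is good, through the whole group and through intervals
respectively. Goodness passes through central extensions (`IsGood.of_central_extension`) via sets
f(W)X, with W in the kernel and X lifting a set of the quotient. X is enlarged first; right
multiplication by finitely many elements then produces only finitely many cocycle values in the
kernel, and W is made invariant under these afterwards. Centrality lets the two tilings combine.

Abelian groups follow by adjoining one element at a time, nilpotent groups by induction on the
quotient by the centre, and finite-index overgroups by multiplying with a transversal
(`IsGood.of_finiteIndex`). -/

/-- `F` is a disjoint union of left translates of `E`, one of which is `E` itself. -/
def LeftTiles {G : Type*} [Group G] (E F : Finset G) : Prop :=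
  ∃ J : Finset G, 1 ∈ J ∧ (∀ y, y ∈ F ↔ ∃ j ∈ J, ∃ e ∈ E, j * e = y) ∧
    ∀ j ∈ J, ∀ j' ∈ J, ∀ e ∈ E, ∀ e' ∈ E, j * e = j' * e' → j = j'

open Classical in
/-- The proportion of points of `F` which right multiplication by `g` moves out of `F` is at
most `ε`. -/
def IsAlmostInvariant {G : Type*} [Group G] (F : Finset G) (g : G) (ε : ℝ) : Prop :=
  ((F.filter fun x => x * g ∉ F).card : ℝ) ≤ ε * F.card

/-- A family of finite sets containing `1`, each of which tiles members of the family that are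
arbitrarily large and arbitrarily invariant. -/
def IsGoodFamily {G : Type*} [Group G] (𝓕 : Set (Finset G)) : Prop :=
  ∀ E ∈ 𝓕, 1 ∈ E ∧ ∀ (K : Finset G) (ε : ℝ), 0 < ε →
    ∃ F ∈ 𝓕, LeftTiles E F ∧ K ⊆ F ∧ ∀ g ∈ K, IsAlmostInvariant F g ε

/-- A finite set that belongs to some good family. -/
def IsGood {G : Type*} [Group G] (E : Finset G) : Prop :=
  ∃ 𝓕 : Set (Finset G), IsGoodFamily 𝓕 ∧ E ∈ 𝓕

/-! ### From good families to congruent monotile sequences. -/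

section General

variable {G : Type*} [Group G]

theorem LeftTiles.refl (E : Finset G) : LeftTiles E E :=
  ⟨{1}, by simp, by simp, by simp⟩

theorem LeftTiles.subset {E F : Finset G} (h : LeftTiles E F) : E ⊆ F := by
  obtain ⟨J, hJ1, hJ, -⟩ := h
  exact fun e he => (hJ e).2 ⟨1, hJ1, e, he, one_mul e⟩

theorem LeftTiles.isLeftTiling {E F : Finset G} (h : LeftTiles E F) :
    ∃ J : Set G, (1 : G) ∈ J ∧ IsLeftTiling J (E : Set G) (F : Set G) := by
  obtain ⟨J, hJ1, hJ, hJi⟩ := h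
  refine ⟨J, hJ1, ?_, ?_⟩
  · intro j hj j' hj' hne
    refine Set.disjoint_left.2 fun x hx hx' => hne ?_
    obtain ⟨e, he, rfl⟩ := Set.mem_smul_set.1 hx
    obtain ⟨e', he', h⟩ := Set.mem_smul_set.1 hx'
    exact hJi j hj j' hj' e he e' he' h.symm
  · ext y
    simp [Set.mem_smul_set, hJ]

/-- A set that tiles every member of an exhaustive sequence compatibly is a monotile. -/
theorem isLeftMonotile_of_leftTiles {F : ℕ → Finset G} (h : ∀ n, LeftTiles (F n) (F (n + 1)))
    (hF : ∀ g, ∃ n, g ∈ F n) (n : ℕ) : IsLeftMonotile (F n) := by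
  classical
  choose J hJ1 hJ hJi using h
  -- `C m` holds the centres of the translates of `F n` that tile `F (n + m)`. Since 1 lies in each
  -- `J`, these sets increase, and their union tiles `G`.
  let C : ℕ → Finset G := fun m => Nat.rec {1} (fun k D => J (n + k) * D) m
  have hC0 : C 0 = {1} := rfl
  have hCs (m) : C (m + 1) = J (n + m) * C m := rfl
  have hmono : Monotone C := monotone_nat_of_le_succ fun m c hc => by
    rw [hCs]
    exact Finset.mem_mul.2 ⟨1, hJ1 _, c, hc, one_mul c⟩
  have hmem (m) : ∀ y, y ∈ F (n + m) ↔ ∃ c ∈ C m, ∃ e ∈ F n, c * e = y := by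
    induction m with
    | zero => simp [hC0]
    | succ m ih =>
      intro y
      rw [← add_assoc, hJ]
      constructor
      · rintro ⟨j, hj, x, hx, rfl⟩
        obtain ⟨c, hc, e, he, rfl⟩ := (ih x).1 hx
        exact ⟨j * c, Finset.mul_mem_mul hj hc, e, he, by group⟩
      · rintro ⟨d, hd, e, he, rfl⟩
        obtain ⟨j, hj, c, hc, rfl⟩ := Finset.mem_mul.1 hd
        exact ⟨j, hj, c * e, (ih _).2 ⟨c, hc, e, he, rfl⟩, by group⟩
  have hinj (m) : ∀ c ∈ C m, ∀ c' ∈ C m, ∀ e ∈ F n, ∀ e' ∈ F n, c * e = c' * e' → c = c' := by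
    induction m with
    | zero => simp [hC0]
    | succ m ih =>
      intro d hd d' hd' e he e' he' h
      obtain ⟨j, hj, c, hc, rfl⟩ := Finset.mem_mul.1 hd
      obtain ⟨j', hj', c', hc', rfl⟩ := Finset.mem_mul.1 hd'
      rw [mul_assoc, mul_assoc] at h
      have h₁ : j = j' := hJi _ j hj j' hj' _ ((hmem m _).2 ⟨c, hc, e, he, rfl⟩) _
        ((hmem m _).2 ⟨c', hc', e', he', rfl⟩) h
      subst h₁
      rw [ih c hc c' hc' e he e' he' (mul_left_cancel h)]
  have hFmono : Monotone F := monotone_nat_of_le_succ fun m =>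
    LeftTiles.subset ⟨J m, hJ1 m, hJ m, hJi m⟩
  refine ⟨{c | ∃ m, c ∈ C m}, ?_, ?_⟩
  · intro c hc c' hc' hne
    obtain ⟨m, hm⟩ := hc
    obtain ⟨m', hm'⟩ := hc'
    refine Set.disjoint_left.2 fun x hx hx' => hne ?_
    obtain ⟨e, he, rfl⟩ := Set.mem_smul_set.1 hx
    obtain ⟨e', he', h⟩ := Set.mem_smul_set.1 hx'
    exact hinj (max m m') c (hmono (le_max_left _ _) hm) c' (hmono (le_max_right _ _) hm')
      e he e' he' h.symm
  · refine Set.eq_univ_of_forall fun g => ?_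
    obtain ⟨m, hm⟩ := hF g
    obtain ⟨c, hc, e, he, rfl⟩ := (hmem m g).1 (hFmono (Nat.le_add_left m n) hm)
    exact Set.mem_iUnion₂.2 ⟨c, ⟨m, hc⟩, Set.mem_smul_set.2 ⟨e, he, rfl⟩⟩

theorem IsAlmostInvariant.ncard_div_le {F : Finset G} {g : G} {ε : ℝ} (hF : F.Nonempty)
    (h : IsAlmostInvariant F g ε) :
    ((((F : Set G) * {g}) \ (F : Set G)).ncard : ℝ) / (F.card : ℝ) ≤ ε := by
  classical
  rw [div_le_iff₀ (by exact_mod_cast hF.card_pos)]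
  refine le_trans ?_ h
  have : ((F : Set G) * {g}) \ (F : Set G) =
      (((F.filter fun x => x * g ∉ F).image (· * g) : Finset G) : Set G) := by
    ext y
    simp only [Set.mul_singleton, Set.mem_sdiff, Set.mem_image, Finset.mem_coe, Finset.mem_image,
      Finset.mem_filter]
    constructor
    · rintro ⟨⟨x, hx, rfl⟩, hy⟩
      exact ⟨x, ⟨hx, hy⟩, rfl⟩
    · rintro ⟨x, ⟨hx, hy⟩, rfl⟩
      exact ⟨⟨x, hx, rfl⟩, hy⟩
  rw [this, Set.ncard_coe_finset]
  exact_mod_cast Finset.card_image_le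

theorem IsGood.isCongruentMonotileable [Countable G] {E : Finset G} (hE : IsGood E) :
    IsCongruentMonotileable G := by
  classical
  obtain ⟨𝓕, h𝓕, hE⟩ := hE
  obtain ⟨a, ha⟩ := exists_surjective_nat G
  have step (n : ℕ) (X : 𝓕) : ∃ Y : 𝓕, LeftTiles X.1 Y.1 ∧
      ∀ k ≤ n, a k ∈ Y.1 ∧ IsAlmostInvariant Y.1 (a k) (1 / (n + 1 : ℝ)) := by
    obtain ⟨F, hF, h₁, h₂, h₃⟩ := (h𝓕 X.1 X.2).2 ((Finset.range (n + 1)).image a)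
      (1 / (n + 1 : ℝ)) (by positivity)
    refine ⟨⟨F, hF⟩, h₁, fun k hk => ?_⟩
    have : a k ∈ (Finset.range (n + 1)).image a :=
      Finset.mem_image_of_mem a (Finset.mem_range.2 (Nat.lt_succ_of_le hk))
    exact ⟨h₂ this, h₃ _ this⟩
  choose next hnext₁ hnext₂ using step
  let S : ℕ → 𝓕 := fun n => Nat.rec ⟨E, hE⟩ next n
  have hS (n) : S (n + 1) = next n (S n) := rfl
  have hmem (n) : (1 : G) ∈ (S n).1 := (h𝓕 _ (S n).2).1
  have hne (n) : (S n).1.Nonempty := ⟨1, hmem n⟩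
  have htile (n) : LeftTiles (S n).1 (S (n + 1)).1 := by rw [hS]; exact hnext₁ n (S n)
  have hex (g : G) : ∃ n, g ∈ (S n).1 := by
    obtain ⟨k, rfl⟩ := ha g
    exact ⟨k + 1, by rw [hS]; exact (hnext₂ k (S k) k le_rfl).1⟩
  refine ⟨fun n => (S n).1, ⟨hne, fun g => ?_⟩, isLeftMonotile_of_leftTiles htile hex,
    ⟨hmem 0, fun n => (htile n).isLeftTiling⟩, ?_⟩
  · obtain ⟨k, rfl⟩ := ha g
    -- The invariance bound `1 / (n + 1)` is known for term `n + 1`, not term `n`.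
    rw [← Filter.tendsto_add_atTop_iff_nat 1]
    refine squeeze_zero' (Filter.Eventually.of_forall fun n => by positivity) ?_
      tendsto_one_div_add_atTop_nhds_zero_nat
    filter_upwards [Filter.eventually_ge_atTop k] with n hn
    refine IsAlmostInvariant.ncard_div_le (hne (n + 1)) ?_
    rw [hS]
    exact (hnext₂ n (S n) k hn).2
  · exact Set.eq_univ_of_forall fun g => by simpa using hex g

/-! ### Base cases: finite and cyclic groups. -/

theorem isGood_one_of_finite [Finite G] : IsGood ({1} : Finset G) := by
  classical
  cases nonempty_fintype G
  refine ⟨{{1}, Finset.univ}, ?_, by simp⟩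
  have hU (g : G) (ε : ℝ) (hε : 0 < ε) : IsAlmostInvariant Finset.univ g ε := by
    simp only [IsAlmostInvariant, Finset.mem_univ, not_true_eq_false, Finset.filter_false,
      Finset.card_empty, Nat.cast_zero]
    positivity
  rintro E (rfl | rfl)
  · exact ⟨by simp, fun K ε hε => ⟨Finset.univ, by simp,
      ⟨Finset.univ, by simp, by simp, by simp⟩, by simp, fun g _ => hU g ε hε⟩⟩
  · exact ⟨by simp, fun K ε hε => ⟨Finset.univ, by simp, LeftTiles.refl _, by simp,
      fun g _ => hU g ε hε⟩⟩

/-- The good family consists of the symmetric intervals [-m, m]. Such an interval tiles any interval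
made of an odd number of copies of it, and a shift by k moves out at most 2|k| points. -/
theorem isGood_one_of_infinite_cyclic (a : G) (ha : ∀ g, ∃ n : ℤ, a ^ n = g)
    (hinj : Function.Injective fun n : ℤ => a ^ n) : IsGood ({1} : Finset G) := by
  classical
  let I : ℕ → Finset G := fun m => (Finset.Icc (-(m : ℤ)) m).image fun n : ℤ => a ^ n
  have hI (m : ℕ) (n : ℤ) : a ^ n ∈ I m ↔ -(m : ℤ) ≤ n ∧ n ≤ m := by
    simp only [I, Finset.mem_image, Finset.mem_Icc]
    exact ⟨fun ⟨k, hk, h⟩ => hinj h ▸ hk, fun h => ⟨n, h, rfl⟩⟩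
  have hcard (m : ℕ) : ((I m).card : ℝ) = 2 * m + 1 := by
    simp only [I]
    rw [Finset.card_image_of_injective _ hinj, Int.card_Icc]
    have : ((m : ℤ) + 1 - -m).toNat = 2 * m + 1 := by omega
    rw [this]
    push_cast
    ring
  have hinv (m : ℕ) (k : ℤ) : (((I m).filter fun x => x * a ^ k ∉ I m).card : ℝ) ≤ 2 * |(k : ℝ)| := by
    have hsub : ((I m).filter fun x => x * a ^ k ∉ I m) ⊆
        ((Finset.Ioc ((m : ℤ) - |k|) m ∪ Finset.Ico (-(m : ℤ)) (-m + |k|)).image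
          fun n : ℤ => a ^ n) := by
      intro x hx
      obtain ⟨n, rfl⟩ := ha x
      rw [Finset.mem_filter, ← zpow_add, hI, hI] at hx
      refine Finset.mem_image_of_mem _ ?_
      simp only [Finset.mem_union, Finset.mem_Ioc, Finset.mem_Ico]
      have := le_abs_self k
      have := neg_abs_le k
      omega
    have h := (Finset.card_le_card hsub).trans
      (Finset.card_image_le.trans (Finset.card_union_le _ _))
    rw [Int.card_Ioc, Int.card_Ico] at h
    have h' : (((I m).filter fun x => x * a ^ k ∉ I m).card : ℤ) ≤ 2 * |k| := by
      have := abs_nonneg k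
      omega
    exact_mod_cast h'
  refine ⟨Set.range I, ?_, 0, by simp [I]⟩
  rintro _ ⟨m, rfl⟩
  refine ⟨by simpa using (hI m 0).2 (by simp), fun K ε hε => ?_⟩
  choose log hlog using ha
  obtain ⟨b, hb⟩ : ∃ b : ℕ, ∀ g ∈ K, |log g| ≤ b := by
    obtain ⟨b, hb⟩ := (K.image fun g => (log g).natAbs).bddAbove
    refine ⟨b, fun g hg => ?_⟩
    have : (log g).natAbs ≤ b := hb (Finset.mem_coe.2 (Finset.mem_image_of_mem _ hg))
    rw [Int.abs_eq_natAbs]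
    exact_mod_cast this
  -- The term `b` puts `K` inside the new interval; the term `2 * b / ε` makes the at most `2 * b`
  -- escaping points negligible.
  obtain ⟨t, ht⟩ := exists_nat_gt (2 * b / ε + b : ℝ)
  have hbt : b ≤ t := by
    have : (b : ℝ) ≤ t := le_trans (by have : (0 : ℝ) ≤ 2 * b / ε := by positivity
                                       linarith) ht.le
    exact_mod_cast this
  have hεt : 2 * (b : ℝ) ≤ ε * t := by
    have : 2 * b / ε ≤ (t : ℝ) := by
      have : (0 : ℝ) ≤ b := by positivity
      linarith
    rwa [div_le_iff₀ hε, mul_comm (t : ℝ)] at this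
  have htM : t ≤ m + t * (2 * m + 1) := by nlinarith
  have hlogabs (g) (hg : g ∈ K) : -(b : ℤ) ≤ log g ∧ log g ≤ b := abs_le.1 (hb g hg)
  -- The radius is chosen so that 2(m + t(2m+1)) + 1 = (2t+1)(2m+1): there are 2t+1 blocks, centred
  -- at multiples of 2m+1.
  refine ⟨I (m + t * (2 * m + 1)), ⟨_, rfl⟩,
    ⟨(Finset.Icc (-(t : ℤ)) t).image fun n : ℤ => a ^ (n * (2 * m + 1)), ?_, ?_, ?_⟩, ?_, ?_⟩
  · exact Finset.mem_image.2 ⟨0, by simp, by simp⟩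
  · intro y
    obtain ⟨n, rfl⟩ : ∃ n : ℤ, a ^ n = y := ⟨_, hlog y⟩
    rw [hI]
    push_cast
    constructor
    · rintro ⟨h₁, h₂⟩
      have hpos : (0 : ℤ) < 2 * m + 1 := by positivity
      -- Dividing n + m rather than n turns remainders in [0, 2m] into offsets in [-m, m].
      have hd := Int.emod_add_mul_ediv (n + m) (2 * m + 1)
      have hr := Int.emod_nonneg (n + m) hpos.ne'
      have hr' := Int.emod_lt_of_pos (n + m) hpos
      set q := (n + m) / (2 * m + 1 : ℤ) with hq
      set r := (n + m) % (2 * m + 1 : ℤ)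
      refine ⟨a ^ (q * (2 * m + 1)), Finset.mem_image_of_mem _ (Finset.mem_Icc.2 ⟨?_, ?_⟩),
        a ^ (r - m), (hI _ _).2 (by omega), ?_⟩
      · rw [hq, Int.le_ediv_iff_mul_le hpos]
        linarith
      · rw [hq]
        refine Int.lt_add_one_iff.1 ((Int.ediv_lt_iff_lt_mul hpos).2 ?_)
        linarith
      · rw [← zpow_add]
        congr 1
        linarith
    · rintro ⟨_, hc, e, he, h⟩
      obtain ⟨j, hj, rfl⟩ := Finset.mem_image.1 hc
      obtain ⟨i, rfl⟩ : ∃ n : ℤ, a ^ n = e := ⟨_, hlog e⟩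
      rw [hI] at he
      rw [Finset.mem_Icc] at hj
      rw [← zpow_add] at h
      have h' : j * (2 * m + 1) + i = n := hinj h
      constructor <;> nlinarith
  · intro c hc c' hc' e he e' he' h
    obtain ⟨j, -, rfl⟩ := Finset.mem_image.1 hc
    obtain ⟨j', -, rfl⟩ := Finset.mem_image.1 hc'
    obtain ⟨i, rfl⟩ : ∃ n : ℤ, a ^ n = e := ⟨_, hlog e⟩
    obtain ⟨i', rfl⟩ : ∃ n : ℤ, a ^ n = e' := ⟨_, hlog e'⟩
    rw [hI] at he he'
    rw [← zpow_add, ← zpow_add] at h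
    have h' : j * (2 * m + 1) + i = j' * (2 * m + 1) + i' := hinj h
    have : j = j' := by
      rcases lt_trichotomy j j' with hlt | heq | hlt
      · nlinarith
      · exact heq
      · nlinarith
    rw [this]
  · intro g hg
    rw [← hlog g, hI]
    have := hlogabs g hg
    zify at htM hbt
    push_cast
    omega
  · intro g hg
    have h₁ := hinv (m + t * (2 * m + 1)) (log g)
    rw [hlog g] at h₁
    have h₂ : |(log g : ℝ)| ≤ b := by exact_mod_cast hb g hg
    have h₃ : (t : ℝ) ≤ ((m + t * (2 * m + 1) : ℕ) : ℝ) := by exact_mod_cast htM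
    rw [IsAlmostInvariant, hcard]
    refine h₁.trans ?_
    nlinarith [Nat.cast_nonneg (α := ℝ) t]

theorem isGood_one_of_isCyclic [IsCyclic G] : IsGood ({1} : Finset G) := by
  cases finite_or_infinite G
  · exact isGood_one_of_finite
  · obtain ⟨a, ha⟩ := IsCyclic.exists_generator (α := G)
    refine isGood_one_of_infinite_cyclic a (fun g => Subgroup.mem_zpowers_iff.1 (ha g)) ?_
    rw [injective_zpow_iff_not_isOfFinOrder, ← orderOf_eq_zero_iff]
    exact Infinite.orderOf_eq_zero_of_forall_mem_zpowers ha

end General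

/-! ### Product sets: finite-index overgroups and central extensions. -/

section Products

variable {N G : Type*} [Group N] [Group G]

open Classical in
/-- The product set `f(W) X`. -/
noncomputable def mapMul (f : N →* G) (W : Finset N) (X : Finset G) : Finset G :=
  (W ×ˢ X).image fun p => f p.1 * p.2

/-- Distinct elements of `X` lie in distinct right cosets of the range of `f`. -/
def IsCosetSeparated (f : N →* G) (X : Finset G) : Prop :=
  ∀ x ∈ X, ∀ x' ∈ X, ∀ n, f n * x = x' → x = x'

theorem mem_mapMul {f : N →* G} {W : Finset N} {X : Finset G} {y : G} :
    y ∈ mapMul f W X ↔ ∃ w ∈ W, ∃ x ∈ X, f w * x = y := by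
  simp only [mapMul, Finset.mem_image, Finset.mem_product, Prod.exists]
  exact ⟨fun ⟨w, x, ⟨hw, hx⟩, h⟩ => ⟨w, hw, x, hx, h⟩, fun ⟨w, hw, x, hx, h⟩ => ⟨w, x, ⟨hw, hx⟩, h⟩⟩

theorem IsCosetSeparated.unique {f : N →* G} (hf : Function.Injective f) {X : Finset G}
    (hX : IsCosetSeparated f X) {x x' : G} (hx : x ∈ X) (hx' : x' ∈ X) {n n' : N}
    (h : f n * x = f n' * x') : n = n' ∧ x = x' := by
  have hxx : x = x' := hX x hx x' hx' (n'⁻¹ * n) (by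
    rw [map_mul, mul_assoc, h, map_inv, inv_mul_cancel_left])
  subst hxx
  exact ⟨hf (mul_right_cancel h), rfl⟩

theorem card_mapMul {f : N →* G} (hf : Function.Injective f) {X : Finset G}
    (hX : IsCosetSeparated f X) (W : Finset N) : (mapMul f W X).card = W.card * X.card := by
  classical
  rw [← Finset.card_product, mapMul]
  refine Finset.card_image_of_injOn ?_
  rintro ⟨w, x⟩ hp ⟨w', x'⟩ hp' h
  simp only [Finset.coe_product, Set.mem_prod, Finset.mem_coe] at hp hp'
  obtain ⟨rfl, rfl⟩ := hX.unique hf hp.2 hp'.2 h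
  rfl

open Classical in
/-- If `X` is almost invariant modulo the range of `f` and `W` is almost invariant under the
corresponding cocycle, then `f(W) X` is almost invariant. -/
theorem isAlmostInvariant_mapMul {f : N →* G} (hf : Function.Injective f) {X : Finset G}
    (hX : IsCosetSeparated f X) {W : Finset N} {g : G} {δ ε : ℝ}
    (h₁ : ((X.filter fun x => ¬∃ n, ∃ x' ∈ X, x * g = f n * x').card : ℝ) ≤ δ * X.card)
    (h₂ : ∀ x ∈ X, ∀ x' ∈ X, ∀ n, x * g = f n * x' → IsAlmostInvariant W n ε) (hε : 0 ≤ ε) :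
    IsAlmostInvariant (mapMul f W X) g (δ + ε) := by
  -- Count fibre by fibre over `X`: either `x * g` leaves all the cosets, which may cost the whole
  -- of `W`, or it acts on `W` as right multiplication by a cocycle value.
  have h₃ : ∀ x ∈ X, (((W.filter fun w => f w * x * g ∉ mapMul f W X).card : ℕ) : ℝ) ≤
      (if ¬∃ n, ∃ x' ∈ X, x * g = f n * x' then (W.card : ℝ) else 0) + ε * W.card := by
    intro x hx
    have hεW : 0 ≤ ε * W.card := by positivity
    by_cases h : ¬∃ n, ∃ x' ∈ X, x * g = f n * x'
    · rw [if_pos h]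
      have : ((W.filter fun w => f w * x * g ∉ mapMul f W X).card : ℝ) ≤ W.card := by
        exact_mod_cast Finset.card_filter_le _ _
      linarith
    · rw [if_neg h]
      obtain ⟨n, x', hx', hn⟩ := not_not.1 h
      rw [zero_add]
      refine le_trans ?_ (h₂ x hx x' hx' n hn)
      refine Nat.cast_le.2 (Finset.card_le_card fun w hw => ?_)
      rw [Finset.mem_filter] at hw ⊢
      refine ⟨hw.1, fun hwn => hw.2 (mem_mapMul.2 ⟨w * n, hwn, x', hx', ?_⟩)⟩
      rw [map_mul, mul_assoc, mul_assoc, hn]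
  have hsub : ((mapMul f W X).filter fun y => y * g ∉ mapMul f W X) ⊆
      X.biUnion fun x => (W.filter fun w => f w * x * g ∉ mapMul f W X).image (f · * x) := by
    intro y hy
    rw [Finset.mem_filter] at hy
    obtain ⟨w, hw, x, hx, rfl⟩ := mem_mapMul.1 hy.1
    exact Finset.mem_biUnion.2 ⟨x, hx,
      Finset.mem_image.2 ⟨w, Finset.mem_filter.2 ⟨hw, hy.2⟩, rfl⟩⟩
  have h₄ := (Finset.card_le_card hsub).trans (Finset.card_biUnion_le.trans
    (Finset.sum_le_sum fun x _ => Finset.card_image_le))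
  rw [IsAlmostInvariant, card_mapMul hf hX]
  calc ((((mapMul f W X).filter fun y => y * g ∉ mapMul f W X).card : ℕ) : ℝ)
      ≤ ∑ x ∈ X, ((W.filter fun w => f w * x * g ∉ mapMul f W X).card : ℝ) := by
        exact_mod_cast h₄
    _ ≤ ∑ x ∈ X, ((if ¬∃ n, ∃ x' ∈ X, x * g = f n * x' then (W.card : ℝ) else 0) +
          ε * W.card) := Finset.sum_le_sum h₃
    _ = (X.filter fun x => ¬∃ n, ∃ x' ∈ X, x * g = f n * x').card * W.card +
          X.card * (ε * W.card) := by
        rw [Finset.sum_add_distrib, ← Finset.sum_filter, Finset.sum_const, Finset.sum_const,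
          nsmul_eq_mul, nsmul_eq_mul]
    _ ≤ (δ * X.card) * W.card + X.card * (ε * W.card) := by gcongr
    _ = (δ + ε) * ((W.card * X.card : ℕ) : ℝ) := by
        push_cast
        ring

/-- The elements `n` with `y = f n * x` for some `y ∈ K` and `x ∈ X` form a finite set. -/
theorem exists_finset_cocycle {f : N →* G} (hf : Function.Injective f) (X K : Finset G) :
    ∃ L : Finset N, ∀ y ∈ K, ∀ x ∈ X, ∀ n, y = f n * x → n ∈ L := by
  classical
  refine ⟨(K * X⁻¹).preimage f hf.injOn, fun y hy x hx n h => ?_⟩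
  rw [Finset.mem_preimage]
  refine Finset.mem_mul.2 ⟨y, hy, x⁻¹, Finset.inv_mem_inv hx, ?_⟩
  rw [h, mul_inv_cancel_right]

/-- Goodness passes to overgroups of finite index. -/
theorem IsGood.of_finiteIndex (H : Subgroup G) [H.FiniteIndex] {E : Finset H} (hE : IsGood E) :
    ∃ F : Finset G, IsGood F := by
  classical
  obtain ⟨T, hT, hT1⟩ := H.exists_isComplement_right 1
  have hTf : T.Finite := hT.finite_right_iff.2 inferInstance
  obtain ⟨T, rfl⟩ := hTf.exists_finset_coe
  have hinj : Function.Injective H.subtype := H.subtype_injective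
  have hex (g : G) : ∃ n, ∃ x ∈ T, g = H.subtype n * x := by
    obtain ⟨⟨n, x⟩, h⟩ := hT.2 g
    exact ⟨n, x, x.2, h.symm⟩
  have hsep : IsCosetSeparated H.subtype T := by
    intro x hx x' hx' n h
    have := hT.1 (a₁ := (n, ⟨x, hx⟩)) (a₂ := (1, ⟨x', hx'⟩)) (by simpa using h)
    simpa using congrArg (fun p => (p.2 : G)) this
  obtain ⟨𝓕, h𝓕, hE⟩ := hE
  refine ⟨mapMul H.subtype E T, (fun W => mapMul H.subtype W T) '' 𝓕, ?_, E, hE, rfl⟩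
  rintro _ ⟨W, hW, rfl⟩
  refine ⟨mem_mapMul.2 ⟨1, (h𝓕 W hW).1, 1, hT1, by simp⟩, fun K ε hε => ?_⟩
  -- As 1 ∈ `T`, the set `L` contains the `H`-components of `K` as well as the cocycle values, so it
  -- serves for both containment and invariance.
  obtain ⟨L, hL⟩ := exists_finset_cocycle hinj T (T * K)
  obtain ⟨W', hW', ⟨J, hJ1, hJ, hJi⟩, hLW', hinv⟩ := (h𝓕 W hW).2 L ε hε
  refine ⟨mapMul H.subtype W' T, ⟨W', hW', rfl⟩, ⟨J.image H.subtype, ?_, ?_, ?_⟩, ?_, ?_⟩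
  · exact Finset.mem_image.2 ⟨1, hJ1, map_one _⟩
  · intro y
    rw [mem_mapMul]
    constructor
    · rintro ⟨w', hw', x, hx, rfl⟩
      obtain ⟨j, hj, w, hw, rfl⟩ := (hJ w').1 hw'
      exact ⟨_, Finset.mem_image_of_mem _ hj, H.subtype w * x, mem_mapMul.2 ⟨w, hw, x, hx, rfl⟩,
        by rw [map_mul, mul_assoc]⟩
    · rintro ⟨_, hj, e, he, rfl⟩
      obtain ⟨j, hm, rfl⟩ := Finset.mem_image.1 hj
      obtain ⟨w, hw, x, hx, rfl⟩ := mem_mapMul.1 he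
      exact ⟨j * w, (hJ _).2 ⟨j, hm, w, hw, rfl⟩, x, hx, by rw [map_mul, mul_assoc]⟩
  · intro c hc c' hc' e he e' he' h
    obtain ⟨j, hj, rfl⟩ := Finset.mem_image.1 hc
    obtain ⟨j', hj', rfl⟩ := Finset.mem_image.1 hc'
    obtain ⟨w, hw, x, hx, rfl⟩ := mem_mapMul.1 he
    obtain ⟨w', hw', x', hx', rfl⟩ := mem_mapMul.1 he'
    rw [← mul_assoc, ← mul_assoc, ← map_mul, ← map_mul] at h
    rw [hJi j hj j' hj' w hw w' hw' (hsep.unique hinj hx hx' h).1]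
  · intro g hg
    obtain ⟨n, x, hx, h⟩ := hex g
    refine mem_mapMul.2 ⟨n, hLW' (hL g ?_ x hx n h), x, hx, h.symm⟩
    exact Finset.mem_mul.2 ⟨1, hT1, g, hg, one_mul g⟩
  · intro g hg
    rw [← zero_add ε]
    refine isAlmostInvariant_mapMul hinj hsep ?_ (fun x hx x' hx' n h => hinv n ?_) hε.le
    · rw [Finset.filter_false_of_mem fun x _ => not_not.2 (hex (x * g))]
      simp
    · exact hL _ (Finset.mul_mem_mul hx hg) x' hx' n h

/-- In a central extension of `Q` by `Z`, the products `f(W) X`, with `W` in a good family of `Z`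
and `X` lifting a member of a good family of `Q`, form a good family. -/
theorem IsGood.of_central_extension {Z Q : Type*} [Group Z] [Group Q] (f : Z →* G) (φ : G →* Q)
    (hf : Function.Injective f) (hφ : Function.Surjective φ) (hker : φ.ker = f.range)
    (hcomm : ∀ z g, f z * g = g * f z) {E : Finset Z} (hE : IsGood E)
    (hQ : IsGood ({1} : Finset Q)) : IsGood (mapMul f E {1}) := by
  classical
  obtain ⟨𝓩, h𝓩, hE⟩ := hE
  obtain ⟨𝓠, h𝓠, hQ⟩ := hQ
  have hφf (z : Z) : φ (f z) = 1 := by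
    rw [← MonoidHom.mem_ker, hker]
    exact ⟨z, rfl⟩
  have hφeq {x y : G} (h : φ x = φ y) : ∃ n, x = f n * y := by
    have : x * y⁻¹ ∈ φ.ker := by rw [MonoidHom.mem_ker, map_mul, h, map_inv, mul_inv_cancel]
    rw [hker] at this
    obtain ⟨n, hn⟩ := this
    exact ⟨n, by rw [hn, inv_mul_cancel_right]⟩
  have hsep {X : Finset G} (hX : Set.InjOn φ X) : IsCosetSeparated f X := by
    intro x hx x' hx' n h
    refine hX hx hx' ?_
    rw [← h, map_mul, hφf, one_mul]
  -- The normalisation `s 1 = 1` keeps 1 in both `X'` and the set of tile centres.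
  obtain ⟨s, hs, hs1⟩ : ∃ s : Q → G, (∀ q, φ (s q) = q) ∧ s 1 = 1 := by
    refine ⟨fun q => if q = 1 then 1 else Function.surjInv hφ q, fun q => ?_, by simp⟩
    dsimp only
    split_ifs with h
    · rw [map_one, h]
    · exact Function.surjInv_eq hφ q
  refine ⟨{F | ∃ W ∈ 𝓩, ∃ X : Finset G, 1 ∈ X ∧ Set.InjOn φ X ∧ X.image φ ∈ 𝓠 ∧
    F = mapMul f W X}, ?_, E, hE, {1}, by simp, by simp, by simpa using hQ, rfl⟩
  rintro _ ⟨W, hW, X, hX1, hXinj, hXQ, rfl⟩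
  refine ⟨mem_mapMul.2 ⟨1, (h𝓩 W hW).1, 1, hX1, by simp⟩, fun K ε hε => ?_⟩
  obtain ⟨Y, hY, ⟨J, hJ1, hJ, hJi⟩, hKY, hYinv⟩ := (h𝓠 _ hXQ).2 (K.image φ) (ε / 2) (half_pos hε)
  set X' : Finset G := J.image s * X with hX'
  have hJX {j : Q} (hj : j ∈ J) {x : G} (hx : x ∈ X) : s j * x ∈ X' :=
    Finset.mul_mem_mul (Finset.mem_image_of_mem s hj) hx
  have hX'mem {y : G} (hy : y ∈ X') : ∃ j ∈ J, ∃ x ∈ X, s j * x = y := by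
    obtain ⟨_, hc, x, hx, rfl⟩ := Finset.mem_mul.1 hy
    obtain ⟨j, hj, rfl⟩ := Finset.mem_image.1 hc
    exact ⟨j, hj, x, hx, rfl⟩
  have hlift {j j' : Q} (hj : j ∈ J) (hj' : j' ∈ J) {x x' : G} (hx : x ∈ X) (hx' : x' ∈ X)
      (h : φ (s j * x) = φ (s j' * x')) : j = j' ∧ x = x' := by
    rw [map_mul, map_mul, hs, hs] at h
    have hjj := hJi j hj j' hj' _ (Finset.mem_image_of_mem φ hx) _
      (Finset.mem_image_of_mem φ hx') h
    subst hjj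
    exact ⟨rfl, hXinj hx hx' (mul_left_cancel h)⟩
  have hX'inj : Set.InjOn φ X' := by
    intro y hy y' hy' h
    obtain ⟨j, hj, x, hx, rfl⟩ := hX'mem hy
    obtain ⟨j', hj', x', hx', rfl⟩ := hX'mem hy'
    obtain ⟨rfl, rfl⟩ := hlift hj hj' hx hx' h
    rfl
  have hX'Y : X'.image φ = Y := by
    ext q
    rw [Finset.mem_image, hJ]
    constructor
    · rintro ⟨y, hy, rfl⟩
      obtain ⟨j, hj, x, hx, rfl⟩ := hX'mem hy
      exact ⟨j, hj, φ x, Finset.mem_image_of_mem φ hx, by rw [map_mul, hs]⟩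
    · rintro ⟨j, hj, e, he, rfl⟩
      obtain ⟨x, hx, rfl⟩ := Finset.mem_image.1 he
      exact ⟨s j * x, hJX hj hx, by rw [map_mul, hs]⟩
  have hX'1 : 1 ∈ X' := by simpa [hs1] using hJX hJ1 hX1
  have hrep {g : G} (hg : φ g ∈ Y) : ∃ n, ∃ x ∈ X', g = f n * x := by
    rw [← hX'Y] at hg
    obtain ⟨x, hx, h⟩ := Finset.mem_image.1 hg
    obtain ⟨n, hn⟩ := hφeq h.symm
    exact ⟨n, x, hx, hn⟩
  obtain ⟨L, hL⟩ := exists_finset_cocycle hf X' (X' * K)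
  obtain ⟨W', hW', ⟨I, hI1, hI, hIi⟩, hLW', hW'inv⟩ := (h𝓩 W hW).2 L (ε / 2) (half_pos hε)
  -- This is the only use of centrality: tile centres from `Z` and from `Q` multiply independently.
  have hswap (i w : Z) (c x : G) : f i * c * (f w * x) = f (i * w) * (c * x) := by
    rw [map_mul, mul_assoc, mul_assoc, ← mul_assoc c, ← hcomm w c, mul_assoc]
  refine ⟨mapMul f W' X', ⟨W', hW', X', hX'1, hX'inj, hX'Y ▸ hY, rfl⟩,
    ⟨mapMul f I (J.image s), ?_, ?_, ?_⟩, ?_, ?_⟩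
  · exact mem_mapMul.2 ⟨1, hI1, 1, Finset.mem_image.2 ⟨1, hJ1, hs1⟩, by simp⟩
  · intro y
    rw [mem_mapMul]
    constructor
    · rintro ⟨w', hw', x', hx', rfl⟩
      obtain ⟨i, hi, w, hw, rfl⟩ := (hI w').1 hw'
      obtain ⟨j, hj, x, hx, rfl⟩ := hX'mem hx'
      exact ⟨f i * s j, mem_mapMul.2 ⟨i, hi, s j, Finset.mem_image_of_mem s hj, rfl⟩,
        f w * x, mem_mapMul.2 ⟨w, hw, x, hx, rfl⟩, hswap _ _ _ _⟩
    · rintro ⟨c, hc, e, he, rfl⟩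
      obtain ⟨i, hi, _, hj, rfl⟩ := mem_mapMul.1 hc
      obtain ⟨j, hm, rfl⟩ := Finset.mem_image.1 hj
      obtain ⟨w, hw, x, hx, rfl⟩ := mem_mapMul.1 he
      exact ⟨i * w, (hI _).2 ⟨i, hi, w, hw, rfl⟩, s j * x, hJX hm hx, (hswap _ _ _ _).symm⟩
  · intro c hc c' hc' e he e' he' h
    obtain ⟨i, hi, _, hj, rfl⟩ := mem_mapMul.1 hc
    obtain ⟨j, hm, rfl⟩ := Finset.mem_image.1 hj
    obtain ⟨w, hw, x, hx, rfl⟩ := mem_mapMul.1 he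
    obtain ⟨i', hi', _, hj', rfl⟩ := mem_mapMul.1 hc'
    obtain ⟨j', hm', rfl⟩ := Finset.mem_image.1 hj'
    obtain ⟨w', hw', x', hx', rfl⟩ := mem_mapMul.1 he'
    rw [hswap, hswap] at h
    obtain ⟨h₁, h₂⟩ := (hsep hX'inj).unique hf (hJX hm hx) (hJX hm' hx') h
    rw [hIi i hi i' hi' w hw w' hw' h₁, (hlift hm hm' hx hx' (congrArg φ h₂)).1]
  · intro g hg
    obtain ⟨n, x, hx, h⟩ := hrep (hKY (Finset.mem_image_of_mem φ hg))
    refine mem_mapMul.2 ⟨n, hLW' (hL g ?_ x hx n h), x, hx, h.symm⟩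
    exact Finset.mem_mul.2 ⟨1, hX'1, g, hg, one_mul g⟩
  · intro g hg
    rw [← add_halves ε]
    refine isAlmostInvariant_mapMul hf (hsep hX'inj) ?_ (fun x hx x' hx' n h => hW'inv n ?_)
      (half_pos hε).le
    · have h := hYinv (φ g) (Finset.mem_image_of_mem φ hg)
      rw [IsAlmostInvariant, ← hX'Y, Finset.card_image_of_injOn hX'inj, hX'Y] at h
      refine le_trans ?_ h
      -- Escaping points are counted in `Q`, where `X'` projects bijectively onto the almost
      -- invariant set `Y`.
      rw [← Finset.card_image_of_injOn (hX'inj.mono (Finset.coe_subset.2 (Finset.filter_subset _ _)))]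
      refine Nat.cast_le.2 (Finset.card_le_card fun q hq => ?_)
      obtain ⟨x, hx, rfl⟩ := Finset.mem_image.1 hq
      rw [Finset.mem_filter] at hx ⊢
      refine ⟨hX'Y ▸ Finset.mem_image_of_mem φ hx.1, fun hxg => hx.2 (hrep ?_)⟩
      rwa [map_mul]
    · exact hL _ (Finset.mul_mem_mul hx hg) x' hx' n h

end Products

/-! ### Abelian and nilpotent groups. -/

section Nilpotent

/-- Goodness of a finite set relative to a subgroup containing it passes to any larger subgroup
generated by one more element. -/
theorem IsGood.map_inclusion {A : Type*} [CommGroup A] {B C : Subgroup A} (hBC : B ≤ C) (a : A)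
    (hC : C ≤ B ⊔ Subgroup.zpowers a) (ha : a ∈ C) {E : Finset B} (hE : IsGood E) :
    IsGood (mapMul (Subgroup.inclusion hBC) E {1}) := by
  set f := Subgroup.inclusion hBC with hf
  have : IsCyclic (C ⧸ f.range) := by
    refine ⟨QuotientGroup.mk ⟨a, ha⟩, fun q => ?_⟩
    obtain ⟨⟨c, hc⟩, rfl⟩ := QuotientGroup.mk_surjective q
    obtain ⟨b, hb, y, hy, rfl⟩ := Subgroup.mem_sup.1 (hC hc)
    obtain ⟨n, rfl⟩ := Subgroup.mem_zpowers_iff.1 hy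
    refine Subgroup.mem_zpowers_iff.2 ⟨n, ?_⟩
    rw [← QuotientGroup.mk_zpow, QuotientGroup.eq]
    refine ⟨⟨b, hb⟩, Subtype.ext ?_⟩
    change b = (a ^ n)⁻¹ * (b * a ^ n)
    rw [mul_comm b, inv_mul_cancel_left]
  exact hE.of_central_extension f (QuotientGroup.mk' f.range) (Subgroup.inclusion_injective hBC)
    (QuotientGroup.mk'_surjective _) (QuotientGroup.ker_mk' _) (fun z g => mul_comm _ _)
    isGood_one_of_isCyclic

theorem mapMul_one_one {N G : Type*} [Group N] [Group G] (f : N →* G) :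
    mapMul f {1} {1} = {1} := by
  ext
  simp [mem_mapMul, eq_comm]

theorem mapMul_mapMul_one {M N G : Type*} [Group M] [Group N] [Group G] (f : M →* N) (g : N →* G)
    (E : Finset M) : mapMul g (mapMul f E {1}) {1} = mapMul (g.comp f) E {1} := by
  ext
  simp [mem_mapMul]

/-- The family consists of the good sets of all subgroups, viewed in `A`. Given `K`, the subgroup is
first enlarged to contain `K` without changing the set; goodness inside it then supplies the larger
tile. -/
theorem isGood_one_of_commGroup (A : Type*) [CommGroup A] : IsGood ({1} : Finset A) := by
  classical
  refine ⟨{F | ∃ (B : Subgroup A) (E : Finset B), IsGood E ∧ F = mapMul B.subtype E {1}}, ?_,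
    ⊥, {1}, isGood_one_of_finite, (mapMul_one_one _).symm⟩
  rintro _ ⟨B, E, hE, rfl⟩
  have h1 {B : Subgroup A} {E : Finset B} (hE : IsGood E) : 1 ∈ mapMul B.subtype E {1} := by
    obtain ⟨𝓕, h𝓕, hE⟩ := hE
    exact mem_mapMul.2 ⟨1, (h𝓕 E hE).1, 1, by simp, by simp⟩
  refine ⟨h1 hE, fun K ε hε => ?_⟩
  -- Elements of `K` are adjoined one by one; each step is a central extension with cyclic quotient.
  obtain ⟨C, hK, E', hE', hEE'⟩ : ∃ C : Subgroup A, (∀ k ∈ K, k ∈ C) ∧ ∃ E' : Finset C,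
      IsGood E' ∧ mapMul C.subtype E' {1} = mapMul B.subtype E {1} := by
    induction K using Finset.induction_on with
    | empty => exact ⟨B, by simp, E, hE, rfl⟩
    | insert a K _ ih =>
      obtain ⟨C, hK, E', hE', h⟩ := ih
      have hle : C ≤ C ⊔ Subgroup.zpowers a := le_sup_left
      have ha : a ∈ C ⊔ Subgroup.zpowers a :=
        (le_sup_right : _ ≤ C ⊔ Subgroup.zpowers a) (Subgroup.mem_zpowers a)
      refine ⟨C ⊔ Subgroup.zpowers a, ?_, mapMul (Subgroup.inclusion hle) E' {1},
        hE'.map_inclusion hle a le_rfl ha, ?_⟩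
      · intro k hk
        rcases Finset.mem_insert.1 hk with rfl | hk
        · exact ha
        · exact hle (hK k hk)
      · rw [mapMul_mapMul_one, Subgroup.subtype_comp_inclusion, h]
  rw [← hEE']
  obtain ⟨𝓕, h𝓕, hE'𝓕⟩ := hE'
  have hinj : Function.Injective C.subtype := C.subtype_injective
  have hsep : IsCosetSeparated C.subtype ({1} : Finset A) := by
    intro x hx x' hx' _ _
    rw [Finset.mem_singleton.1 hx, Finset.mem_singleton.1 hx']
  have hmem {F : Finset C} {y : A} : y ∈ mapMul C.subtype F {1} ↔ ∃ w ∈ F, (w : A) = y := by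
    simp [mem_mapMul]
  obtain ⟨L, hL⟩ := exists_finset_cocycle hinj {1} K
  obtain ⟨F, hF, ⟨J, hJ1, hJ, hJi⟩, hLF, hinv⟩ := (h𝓕 E' hE'𝓕).2 L ε hε
  refine ⟨mapMul C.subtype F {1}, ⟨C, F, ⟨𝓕, h𝓕, hF⟩, rfl⟩, ⟨J.image C.subtype, ?_, ?_, ?_⟩,
    ?_, ?_⟩
  · exact Finset.mem_image.2 ⟨1, hJ1, rfl⟩
  · intro y
    rw [hmem]
    constructor
    · rintro ⟨w, hw, rfl⟩
      obtain ⟨j, hj, e, he, rfl⟩ := (hJ w).1 hw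
      exact ⟨j, Finset.mem_image_of_mem C.subtype hj, e, hmem.2 ⟨e, he, rfl⟩, rfl⟩
    · rintro ⟨_, hj, e, he, rfl⟩
      obtain ⟨j, hm, rfl⟩ := Finset.mem_image.1 hj
      obtain ⟨w, hw, rfl⟩ := hmem.1 he
      exact ⟨j * w, (hJ _).2 ⟨j, hm, w, hw, rfl⟩, rfl⟩
  · intro c hc c' hc' e he e' he' h
    obtain ⟨j, hj, rfl⟩ := Finset.mem_image.1 hc
    obtain ⟨j', hj', rfl⟩ := Finset.mem_image.1 hc'
    obtain ⟨w, hw, rfl⟩ := hmem.1 he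
    obtain ⟨w', hw', rfl⟩ := hmem.1 he'
    rw [hJi j hj j' hj' w hw w' hw' (Subtype.ext h)]
  · intro k hk
    exact hmem.2 ⟨⟨k, hK k hk⟩, hLF (hL k hk 1 (by simp) _ (by simp)), rfl⟩
  · intro k hk
    rw [← zero_add ε]
    have hrep (x : A) (hx : x ∈ ({1} : Finset A)) : x * k = C.subtype ⟨k, hK k hk⟩ * 1 := by
      rw [Finset.mem_singleton.1 hx, one_mul, mul_one, Subgroup.subtype_apply]
    refine isAlmostInvariant_mapMul hinj hsep ?_ (fun x hx x' hx' n h => hinv n ?_) hε.le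
    · rw [Finset.filter_false_of_mem fun x hx => not_not.2 ⟨_, 1, by simp, hrep x hx⟩]
      simp
    · rw [Finset.mem_singleton.1 hx, one_mul] at h
      exact hL k hk x' hx' n h

/-- The group is a central extension of its quotient by the centre, which is good by induction, and
the centre is good because it is abelian. -/
theorem isGood_one_of_isNilpotent (G : Type*) [Group G] [Group.IsNilpotent G] :
    IsGood ({1} : Finset G) := by
  refine Group.nilpotent_center_quotient_ind (P := fun G _ _ => IsGood ({1} : Finset G)) G
    (fun G _ _ => isGood_one_of_finite) fun G _ _ ih => ?_
  let _ : CommGroup (Subgroup.center G) :=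
    { (inferInstance : Group (Subgroup.center G)) with mul_comm := mul_comm' }
  rw [← mapMul_one_one (Subgroup.center G).subtype]
  exact (isGood_one_of_commGroup (Subgroup.center G)).of_central_extension _
    (QuotientGroup.mk' _) (Subgroup.subtype_injective _) (QuotientGroup.mk'_surjective _)
    (by rw [QuotientGroup.ker_mk', Subgroup.range_subtype])
    (fun z g => (Subgroup.mem_center_iff.1 z.2 g).symm) ih

end Nilpotent

theorem theorem1 {G : Type*} [Group G] [Countable G] (hG : Group.IsVirtuallyNilpotent G) :
    IsCongruentMonotileable G := by
  obtain ⟨N, hN, hfin⟩ := hG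
  obtain ⟨F, hF⟩ := (isGood_one_of_isNilpotent N).of_finiteIndex
  exact hF.isCongruentMonotileable
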